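/- Let $n$ be a non-negative integer. A halved alternating sign matrix of order $2n$ is an $n\times 2n$ matrix $A=(a_{ij})_{1\le i\le n,\,1\le j\le 2n}$ with entries in $\{0,1,-1\}$ such that the non-zero entries alternate in sign along each row and each column, every row sum equals $1$, and the first non-zero entry of each column (if there is any) is $1$. Its height matrix is the $(n+1)\times(2n+1)$ matrix $h$ with entries $h_{ij}=i+j-2\sum_{l=1}^{i}\sum_{r=1}^{j}a_{lr}$ for $0\le i\le n$, $0\le j\le 2n$. Let $\mathcal H_n$ be the set of halved alternating sign matrices of order $2n$ whose height matrix has first row $0,1,2,\dots,2n$, first column $0,1,\dots,n$, last column $2n,2n-1,\dots,n$, and last row of the form $n,c_1,n,c_2,n,\dots,n,c_n,n$ (that is, $h_{n,2k}=n$ for $0\le k\le n$, with $c_1,\dots,c_n$ arbitrary). Call a position $(i,j)$ even or odd according to whether $i+j$ is even or odd, and for $A\in\mathcal H_n$ let $N_-(A,\mathrm{even})$ be the number of entries $-1$ of $A$ in even position and $N_+(A,\mathrm{odd})$ the number of entries $1$ of $A$ in odd position. Then $$\sum_{A\in\mathcal H_n}2^{N_-(A,\mathrm{even})+N_+(A,\mathrm{odd})}=3^n\,5^{\binom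 n2}.$$ -/

import Mathlib

/-- The non-zero entries of a finite sequence of signs `0, 1, -1` alternate: any two
consecutive non-zero entries are opposite. -/
def Alternates {m : ℕ} (v : Fin m → SignType) : Prop :=
  ∀ i j : Fin m, i < j → v i ≠ 0 → v j ≠ 0 →
    (∀ k : Fin m, i < k → k < j → v k = 0) → v j = -v i

/-- Halved alternating sign matrices of order `2 * n`: rectangles with `n` rows, `2 * n` columns
and entries `0, 1, -1` (elements of `SignType`). -/
structure IsHalvedASM {n : ℕ} (A : Matrix (Fin n) (Fin (2 * n)) SignType) : Prop where
  row_alternates : ∀ i, Alternates (fun j => A i j)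
  col_alternates : ∀ j, Alternates (fun i => A i j)
  row_sum : ∀ i, ∑ j, (A i j : ℤ) = 1
  col_first : ∀ i j, A i j ≠ 0 → (∀ k, k < i → A k j = 0) → A i j = 1

/-- The height matrix `h i j = i + j - 2 * ∑ (l ≤ i, r ≤ j) a l r`, `0 ≤ i ≤ n`, `0 ≤ j ≤ 2 * n`.
The rows and columns of `A` are numbered from `0` here, so the first `i` rows are those with
index `l < i`, and similarly for columns. -/
def heightMatrix {n : ℕ} (A : Matrix (Fin n) (Fin (2 * n)) SignType) :
    Matrix (Fin (n + 1)) (Fin (2 * n + 1)) ℤ :=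
  fun i j => (i.val : ℤ) + (j.val : ℤ) -
    2 * ∑ l : Fin n with l.val < i.val, ∑ r : Fin (2 * n) with r.val < j.val, (A l r : ℤ)

/-- The prescribed form of a height matrix: first row `0, 1, …, 2 * n`, first column `0, 1, …, n`,
last column `2 * n, 2 * n - 1, …, n`, last row `n, c₁, n, c₂, n, …, n, cₙ, n` with arbitrary
entries `c₁, …, cₙ`; the entries inside are arbitrary. -/
structure HasBoundaryForm {n : ℕ} (h : Matrix (Fin (n + 1)) (Fin (2 * n + 1)) ℤ) : Prop where
  first_row : ∀ j, h 0 j = (j.val : ℤ)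
  first_col : ∀ i, h i 0 = (i.val : ℤ)
  last_col : ∀ i, h i (Fin.last (2 * n)) = 2 * (n : ℤ) - (i.val : ℤ)
  last_row : ∀ j : Fin (2 * n + 1), Even j.val → h (Fin.last n) j = (n : ℤ)

/-- The number of entries `-1` in even position. Counting rows and columns from `1`, the
position of `A i j` is `(i + 1, j + 1)`. -/
def numNegEven {n : ℕ} (A : Matrix (Fin n) (Fin (2 * n)) SignType) : ℕ :=
  Finset.card {p : Fin n × Fin (2 * n) |
    A p.1 p.2 = -1 ∧ Even ((p.1.val + 1) + (p.2.val + 1))}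

/-- The number of entries `1` in odd position. -/
def numPosOdd {n : ℕ} (A : Matrix (Fin n) (Fin (2 * n)) SignType) : ℕ :=
  Finset.card {p : Fin n × Fin (2 * n) |
    A p.1 p.2 = 1 ∧ Odd ((p.1.val + 1) + (p.2.val + 1))}

open Classical in
/-- The (finite) set of halved alternating sign matrices of order `2 * n` whose height matrix has
the prescribed form. -/
noncomputable def boundedHalvedASMs (n : ℕ) : Finset (Matrix (Fin n) (Fin (2 * n)) SignType) :=
  {A | IsHalvedASM A ∧ HasBoundaryForm (heightMatrix A)}

/-! In a halved alternating sign matrix all partial row and column sums are `0` or `1`. After each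
row, the columns with sum `1` form a set, and the sets after successive rows interlace: the matrices
are monotone triangles. The weights of `1` and `-1` at any one position have product `2`. Hence the
weight of a row splits into a factor for the new set and a factor for the old one, where an old
column that is kept counts half (`prod_entryWeight_indicatorDiff`).

These halves make the sum over interlacing sets telescope inside a determinant. So the weighted
count of rectangles with prescribed column support `x` is a determinant with entries `stepFun … a (x
b)`, one iterated weighted sum per column (`rectSum_image`).

The boundary form says that each pair of columns `2 k`, `2 k + 1` contains exactly one column of sum
`1`. By multilinearity, summing over these choices adds the values at `2 k` and `2 k + 1` within
each row (`sum_det_pairChoice`). On each parity class `stepFun` is a polynomial in `k` of degree at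
most `a`, with top binomial coefficient `5 ^ a` times `1` or `2` (`isBinomialSum_stepFun`). The pair
sums have top coefficient `3 * 5 ^ a`, and the determinant is the product of these
(`det_isBinomialSum`). -/

/-! ### Alternating sign sequences and partial sums -/

/-- The sum of the entries of `v` with index less than `k`. -/
def prefixSum {m : ℕ} (v : Fin m → SignType) (k : ℕ) : ℤ :=
  ∑ j : Fin m with j.val < k, (v j : ℤ)

/-- All partial sums of the sequence are `0` or `1`. -/
def BinaryPrefixSums {m : ℕ} (v : Fin m → SignType) : Prop :=
  ∀ k, prefixSum v k = 0 ∨ prefixSum v k = 1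

theorem prefixSum_zero {m : ℕ} (v : Fin m → SignType) : prefixSum v 0 = 0 := by
  simp [prefixSum]

theorem Fin.sum_filter_val_lt_succ {m : ℕ} (f : Fin m → ℤ) (k : Fin m) :
    ∑ j : Fin m with j.val < k.val + 1, f j = ∑ j : Fin m with j.val < k.val, f j + f k := by
  have : (Finset.univ.filter fun j : Fin m => j.val < k.val + 1) =
      insert k (Finset.univ.filter fun j : Fin m => j.val < k.val) := by
    ext j
    simp only [Finset.mem_filter, Finset.mem_univ, true_and, Finset.mem_insert, Fin.ext_iff]
    omega
  rw [this, Finset.sum_insert (by simp), add_comm]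

theorem prefixSum_succ {m : ℕ} (v : Fin m → SignType) (k : Fin m) :
    prefixSum v (k + 1) = prefixSum v k + v k :=
  Fin.sum_filter_val_lt_succ _ k

theorem prefixSum_of_le {m : ℕ} (v : Fin m → SignType) {k : ℕ} (hk : m ≤ k) :
    prefixSum v k = ∑ j, (v j : ℤ) := by
  rw [prefixSum, Finset.filter_true_of_mem fun j _ => by omega]

theorem prefixSum_congr_of_zero {m : ℕ} (v : Fin m → SignType) {k l : ℕ} (hkl : k ≤ l)
    (h : ∀ j : Fin m, k ≤ j.val → j.val < l → v j = 0) : prefixSum v l = prefixSum v k := by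
  symm
  refine Finset.sum_subset (fun j => ?_) fun j hj hj' => ?_
  · simp only [Finset.mem_filter, Finset.mem_univ, true_and]; omega
  · simp only [Finset.mem_filter, Finset.mem_univ, true_and, not_lt] at hj hj'
    simp [h j hj' hj]

theorem prefixSum_neg {m : ℕ} (v : Fin m → SignType) (k : ℕ) :
    prefixSum (-v) k = -prefixSum v k := by
  simp [prefixSum]

/-- The induction must remember the last non-zero entry before `k`, since alternation only compares
consecutive non-zero entries; that entry determines the partial sum. -/
theorem prefixSum_dichotomy {m : ℕ} (v : Fin m → SignType) (halt : Alternates v)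
    (hfirst : ∀ i, v i ≠ 0 → (∀ k, k < i → v k = 0) → v i = 1) (k : ℕ) (hk : k ≤ m) :
    (prefixSum v k = 0 ∧ ((∀ i : Fin m, i.val < k → v i = 0) ∨
      ∃ i : Fin m, i.val < k ∧ v i = -1 ∧ ∀ l : Fin m, i < l → l.val < k → v l = 0)) ∨
    (prefixSum v k = 1 ∧
      ∃ i : Fin m, i.val < k ∧ v i = 1 ∧ ∀ l : Fin m, i < l → l.val < k → v l = 0) := by
  induction k with
  | zero => exact Or.inl ⟨prefixSum_zero v, Or.inl fun i hi => absurd hi (Nat.not_lt_zero _)⟩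
  | succ k ih =>
    let K : Fin m := ⟨k, hk⟩
    have hs : prefixSum v (k + 1) = prefixSum v k + v K := prefixSum_succ v K
    have hlt : ∀ l : Fin m, l.val < k + 1 → l.val < k ∨ l = K := fun l hl => by
      rw [Fin.ext_iff]; change _ ∨ l.val = k; omega
    by_cases h0 : v K = 0
    · rw [hs, h0]
      simp only [SignType.coe_zero, add_zero]
      have hz : ∀ i : Fin m, (∀ l : Fin m, i < l → l.val < k → v l = 0) →
          ∀ l : Fin m, i < l → l.val < k + 1 → v l = 0 := fun i h l hil hl => by
        rcases hlt l hl with h1 | rfl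
        · exact h l hil h1
        · exact h0
      rcases ih (by omega) with ⟨h, h' | ⟨i, hi, hv, h'⟩⟩ | ⟨h, i, hi, hv, h'⟩
      · refine Or.inl ⟨h, Or.inl fun l hl => ?_⟩
        rcases hlt l hl with h1 | rfl
        · exact h' l h1
        · exact h0
      · exact Or.inl ⟨h, Or.inr ⟨i, by omega, hv, hz i h'⟩⟩
      · exact Or.inr ⟨h, i, by omega, hv, hz i h'⟩
    · have hKl : ∀ l : Fin m, K < l → l.val < k + 1 → v l = 0 := fun l h1 h2 => by
        have : k < l.val := h1
        omega
      rcases ih (by omega) with ⟨h, h' | ⟨i, hi, hv, h'⟩⟩ | ⟨h, i, hi, hv, h'⟩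
      · have h1 := hfirst K h0 fun l hl => h' l hl
        exact Or.inr ⟨by rw [hs, h, h1]; rfl, K, Nat.lt_succ_self k, h1, hKl⟩
      · have h1 : v K = 1 := by
          rw [halt i K hi (by rw [hv]; decide) h0 fun l h1 h2 => h' l h1 h2, hv]; decide
        exact Or.inr ⟨by rw [hs, h, h1]; rfl, K, Nat.lt_succ_self k, h1, hKl⟩
      · have h1 : v K = -1 := by
          rw [halt i K hi (by rw [hv]; decide) h0 fun l h1 h2 => h' l h1 h2, hv]
        exact Or.inl ⟨by rw [hs, h, h1]; rfl, Or.inr ⟨K, Nat.lt_succ_self k, h1, hKl⟩⟩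

theorem alternates_and_first_iff {m : ℕ} (v : Fin m → SignType) :
    (Alternates v ∧ ∀ i, v i ≠ 0 → (∀ k, k < i → v k = 0) → v i = 1) ↔ BinaryPrefixSums v := by
  constructor
  · rintro ⟨h1, h2⟩ k
    rcases le_total k m with hk | hk
    · rcases prefixSum_dichotomy v h1 h2 k hk with h | h
      exacts [Or.inl h.1, Or.inr h.1]
    · rw [prefixSum_of_le v hk, ← prefixSum_of_le v le_rfl]
      rcases prefixSum_dichotomy v h1 h2 m le_rfl with h | h
      exacts [Or.inl h.1, Or.inr h.1]
  · intro h
    constructor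
    · intro i j hij hi hj hz
      have hp : prefixSum v j = prefixSum v (i + 1) :=
        prefixSum_congr_of_zero v hij fun l hl1 hl2 => hz l hl1 hl2
      have hi' := prefixSum_succ v i
      have hj' := prefixSum_succ v j
      have e1 := h i
      have e2 := h (i + 1)
      have e3 := h (j + 1)
      rcases hvi : v i with _ | _ | _ <;> rcases hvj : v j with _ | _ | _ <;>
        simp_all <;> omega
    · intro i hi hz
      have hp : prefixSum v i = prefixSum v 0 :=
        prefixSum_congr_of_zero v (Nat.zero_le _) fun l _ hl2 => hz l hl2
      have hi' := prefixSum_succ v i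
      have e2 := h (i + 1)
      rw [hp, prefixSum_zero] at hi'
      rcases hvi : v i with _ | _ | _ <;> simp_all

/-- If an alternating sequence began with `-1`, its negative would have partial sums `0` or `1`, so
the total could not be `1`. Rows thus obey the same condition as columns. -/
theorem alternates_and_sum_iff {m : ℕ} (v : Fin m → SignType) :
    (Alternates v ∧ ∑ j, (v j : ℤ) = 1) ↔ (BinaryPrefixSums v ∧ ∑ j, (v j : ℤ) = 1) := by
  constructor
  · rintro ⟨h, hs⟩
    refine ⟨(alternates_and_first_iff v).1 ⟨h, fun i hi hz => ?_⟩, hs⟩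
    by_contra hne
    have hneg : v i = -1 := by
      rcases hvi : v i with _ | _ | _ <;> simp_all
    have halt : Alternates (-v) := fun a b hab ha hb hz' => by
      have := h a b hab (by simpa using ha) (by simpa using hb) (by simpa using hz')
      simp [this]
    have hfirst : ∀ a, (-v) a ≠ 0 → (∀ k, k < a → (-v) k = 0) → (-v) a = 1 := by
      intro a ha hza
      rcases lt_trichotomy a i with hai | rfl | hai
      · exact absurd (hz a hai) (by simpa using ha)
      · simp [hneg]
      · exact absurd (hza i hai) (by simpa using hi)
    have hb := (alternates_and_first_iff (-v)).1 ⟨halt, hfirst⟩ m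
    rw [prefixSum_neg, prefixSum_of_le v le_rfl, hs] at hb
    omega
  · rintro ⟨h, hs⟩
    exact ⟨((alternates_and_first_iff v).2 h).1, hs⟩

/-! ### Rectangles built row by row -/

/-- Rectangular matrices with entries `0, 1, -1` such that all partial row and column sums are
`0` or `1`, and all row sums are `1`. -/
structure IsHalvedRect {m N : ℕ} (A : Fin m → Fin N → SignType) : Prop where
  row : ∀ i, BinaryPrefixSums (A i)
  row_sum : ∀ i, ∑ j, (A i j : ℤ) = 1
  col : ∀ j, BinaryPrefixSums fun i => A i j

theorem isHalvedASM_iff {n : ℕ} (A : Matrix (Fin n) (Fin (2 * n)) SignType) :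
    IsHalvedASM A ↔ IsHalvedRect (fun i j => A i j) := by
  constructor
  · intro h
    exact ⟨fun i => ((alternates_and_sum_iff _).1 ⟨h.row_alternates i, h.row_sum i⟩).1, h.row_sum,
      fun j => (alternates_and_first_iff _).1 ⟨h.col_alternates j, fun i => h.col_first i j⟩⟩
  · intro h
    exact ⟨fun i => ((alternates_and_sum_iff _).2 ⟨h.row i, h.row_sum i⟩).1,
      fun j => ((alternates_and_first_iff _).2 (h.col j)).1, h.row_sum,
      fun i j => ((alternates_and_first_iff _).2 (h.col j)).2 i⟩

theorem BinaryPrefixSums.sum_eq {m : ℕ} {v : Fin m → SignType} (h : BinaryPrefixSums v) :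
    ∑ i, (v i : ℤ) = 0 ∨ ∑ i, (v i : ℤ) = 1 := by
  simpa only [prefixSum_of_le v le_rfl] using h m

theorem prefixSum_snoc_of_le {m : ℕ} (v : Fin m → SignType) (s : SignType) {k : ℕ} (hk : k ≤ m) :
    prefixSum (Fin.snoc v s : Fin (m + 1) → SignType) k = prefixSum v k := by
  simp only [prefixSum, Finset.sum_filter, Fin.sum_univ_castSucc, Fin.snoc_castSucc,
    Fin.snoc_last, Fin.val_castSucc, Fin.val_last, if_neg (not_lt.2 hk), add_zero]

theorem binaryPrefixSums_snoc_iff {m : ℕ} (v : Fin m → SignType) (s : SignType) :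
    BinaryPrefixSums (Fin.snoc v s : Fin (m + 1) → SignType) ↔
      BinaryPrefixSums v ∧ (∑ i, (v i : ℤ) + s = 0 ∨ ∑ i, (v i : ℤ) + s = 1) := by
  have hsum : ∑ i, ((Fin.snoc v s : Fin (m + 1) → SignType) i : ℤ) = ∑ i, (v i : ℤ) + s := by
    simp [Fin.sum_univ_castSucc]
  constructor
  · intro h
    refine ⟨fun k => ?_, hsum ▸ h.sum_eq⟩
    rcases le_total k m with hk | hk
    · rw [← prefixSum_snoc_of_le v s hk]; exact h k
    · rw [prefixSum_of_le v hk, ← prefixSum_of_le v le_rfl, ← prefixSum_snoc_of_le v s le_rfl]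
      exact h m
  · rintro ⟨h, hs⟩ k
    rcases Nat.lt_or_ge m k with hk | hk
    · rw [prefixSum_of_le _ hk, hsum]; exact hs
    · rw [prefixSum_snoc_of_le v s hk]; exact h k

/-- The column sums of `A` are the indicator of `X`. -/
def HasColumnSupport {m N : ℕ} (A : Fin m → Fin N → SignType) (X : Finset (Fin N)) : Prop :=
  ∀ j, ∑ i, (A i j : ℤ) = if j ∈ X then 1 else 0

/-- The difference of the indicators of `X` and `Y`. -/
def indicatorDiff {N : ℕ} (X Y : Finset (Fin N)) (j : Fin N) : SignType :=
  if j ∈ X then if j ∈ Y then 0 else 1 else if j ∈ Y then -1 else 0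

theorem coe_indicatorDiff {N : ℕ} (X Y : Finset (Fin N)) (j : Fin N) :
    (indicatorDiff X Y j : ℤ) = (if j ∈ X then 1 else 0) - (if j ∈ Y then 1 else 0) := by
  unfold indicatorDiff
  split_ifs <;> simp

theorem signType_coe_injective : Function.Injective fun s : SignType => (s : ℤ) := by
  decide

/-- The row leading from column support `Y` to column support `X` is admissible. -/
def IsRowStep {N : ℕ} (X Y : Finset (Fin N)) : Prop :=
  BinaryPrefixSums (indicatorDiff X Y) ∧ ∑ j, (indicatorDiff X Y j : ℤ) = 1

theorem isHalvedRect_snoc_iff {m N : ℕ} (B : Fin m → Fin N → SignType) (r : Fin N → SignType) :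
    IsHalvedRect (Fin.snoc B r : Fin (m + 1) → Fin N → SignType) ↔
      IsHalvedRect B ∧ BinaryPrefixSums r ∧ ∑ j, (r j : ℤ) = 1 ∧
        ∀ j, ∑ i, (B i j : ℤ) + r j = 0 ∨ ∑ i, (B i j : ℤ) + r j = 1 := by
  have hcol : ∀ j, (fun i => (Fin.snoc B r : Fin (m + 1) → Fin N → SignType) i j) =
      (Fin.snoc (fun i => B i j) (r j) : Fin (m + 1) → SignType) := fun j => by
    funext i
    refine Fin.lastCases ?_ (fun i => ?_) i <;> simp
  constructor
  · intro h
    have hc := fun j => (binaryPrefixSums_snoc_iff _ _).1 (hcol j ▸ h.col j)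
    refine ⟨⟨fun i => ?_, fun i => ?_, fun j => (hc j).1⟩, ?_, ?_, fun j => (hc j).2⟩
    · simpa using h.row i.castSucc
    · simpa using h.row_sum i.castSucc
    · simpa using h.row (Fin.last m)
    · simpa using h.row_sum (Fin.last m)
  · rintro ⟨h, h1, h2, h3⟩
    refine ⟨fun i => ?_, fun i => ?_, fun j => ?_⟩
    · refine Fin.lastCases ?_ (fun i => ?_) i
      · simpa using h1
      · simpa using h.row i
    · refine Fin.lastCases ?_ (fun i => ?_) i
      · simpa using h2
      · simpa using h.row_sum i
    · rw [hcol j]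
      exact (binaryPrefixSums_snoc_iff _ _).2 ⟨h.col j, h3 j⟩

/-! ### Weighted sums by column support -/

/-- The weight of an entry at position `(i, j)`. -/
def entryWeight (cp cm : ℕ → ℕ → ℚ) (i j : ℕ) (s : SignType) : ℚ :=
  if s = 1 then cp i j else if s = -1 then cm i j else 1

/-- The product of the weights of all entries. -/
def rectWeight (cp cm : ℕ → ℕ → ℚ) {m N : ℕ} (A : Fin m → Fin N → SignType) : ℚ :=
  ∏ i : Fin m, ∏ j : Fin N, entryWeight cp cm i j (A i j)

open Classical in
/-- The weighted number of rectangles with `m` rows and column support `X`. -/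
noncomputable def rectSum (cp cm : ℕ → ℕ → ℚ) {N : ℕ} (m : ℕ) (X : Finset (Fin N)) : ℚ :=
  ∑ A : Fin m → Fin N → SignType with IsHalvedRect A ∧ HasColumnSupport A X, rectWeight cp cm A

/-- The set of columns with sum `1`. -/
def columnSupport {m N : ℕ} (A : Fin m → Fin N → SignType) : Finset (Fin N) :=
  {j | ∑ i, (A i j : ℤ) = 1}

theorem IsHalvedRect.hasColumnSupport {m N : ℕ} {A : Fin m → Fin N → SignType}
    (h : IsHalvedRect A) : HasColumnSupport A (columnSupport A) := by
  intro j
  rcases (h.col j).sum_eq with h0 | h0 <;> simp [columnSupport, h0]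

theorem HasColumnSupport.eq {m N : ℕ} {A : Fin m → Fin N → SignType} {X : Finset (Fin N)}
    (h : HasColumnSupport A X) : columnSupport A = X := by
  ext j
  have := h j
  by_cases hj : j ∈ X <;> simp_all [columnSupport]

theorem rectSum_zero (cp cm : ℕ → ℕ → ℚ) {N : ℕ} :
    rectSum cp cm 0 (∅ : Finset (Fin N)) = 1 := by
  classical
  rw [rectSum, Finset.filter_true_of_mem]
  · simp [rectWeight]
  · intro A _
    exact ⟨⟨fun i => i.elim0, fun i => i.elim0, fun j k => by simp [prefixSum]⟩,
      fun j => by simp⟩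

theorem eq_indicatorDiff_of_hasColumnSupport {m N : ℕ} {B : Fin m → Fin N → SignType}
    {r : Fin N → SignType} {X Y : Finset (Fin N)} (hB : HasColumnSupport B Y)
    (h : HasColumnSupport (Fin.snoc B r : Fin (m + 1) → Fin N → SignType) X) :
    r = indicatorDiff X Y := by
  funext j
  apply signType_coe_injective
  have e1 := h j
  have e2 := hB j
  simp only [Fin.sum_univ_castSucc, Fin.snoc_castSucc, Fin.snoc_last] at e1
  simp only [coe_indicatorDiff, ← e1, ← e2]
  ring

-- The last row is forced by the column supports before and after it, so removing it is a bijection.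
open Classical in
theorem rectSum_succ (cp cm : ℕ → ℕ → ℚ) {N : ℕ} (m : ℕ) (X : Finset (Fin N)) :
    rectSum cp cm (m + 1) X = ∑ Y with IsRowStep X Y,
      (∏ j : Fin N, entryWeight cp cm m j (indicatorDiff X Y j)) * rectSum cp cm m Y := by
  simp only [rectSum, Finset.mul_sum]
  rw [Finset.sum_sigma']
  symm
  refine Finset.sum_nbij' (fun p => Fin.snoc p.2 (indicatorDiff X p.1))
    (fun A => ⟨columnSupport (Fin.init A), Fin.init A⟩) ?_ ?_ ?_ ?_ ?_
  · rintro ⟨Y, B⟩ h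
    simp only [Finset.mem_sigma, Finset.mem_filter, Finset.mem_univ, true_and] at h ⊢
    obtain ⟨⟨h1, h2⟩, h3, h4⟩ := h
    have hX : ∀ j, ∑ i, (B i j : ℤ) + indicatorDiff X Y j = if j ∈ X then 1 else 0 := fun j => by
      rw [h4 j, coe_indicatorDiff]; ring
    refine ⟨(isHalvedRect_snoc_iff _ _).2 ⟨h3, h1, h2, fun j => ?_⟩, fun j => ?_⟩
    · rw [hX]; split_ifs <;> simp
    · rw [← hX]; simp [Fin.sum_univ_castSucc]
  · intro A h
    simp only [Finset.mem_sigma, Finset.mem_filter, Finset.mem_univ, true_and] at h ⊢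
    rw [← Fin.snoc_init_self A] at h
    obtain ⟨hB, hr, hs, -⟩ := (isHalvedRect_snoc_iff _ _).1 h.1
    have hrow := eq_indicatorDiff_of_hasColumnSupport hB.hasColumnSupport h.2
    exact ⟨⟨hrow ▸ hr, hrow ▸ hs⟩, hB, hB.hasColumnSupport⟩
  · rintro ⟨Y, B⟩ h
    simp only [Finset.mem_sigma, Finset.mem_filter, Finset.mem_univ, true_and] at h
    have : columnSupport B = Y := h.2.2.eq
    simp [this]
  · intro A h
    simp only [Finset.mem_filter, Finset.mem_univ, true_and] at h ⊢
    rw [← Fin.snoc_init_self A] at h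
    have hB := ((isHalvedRect_snoc_iff _ _).1 h.1).1
    rw [← eq_indicatorDiff_of_hasColumnSupport hB.hasColumnSupport h.2, Fin.snoc_init_self]
  · rintro ⟨Y, B⟩ h
    simp [rectWeight, Fin.prod_univ_castSucc, mul_comm]

/-! ### Row steps as interlacing tuples -/

/-- `x` and `y` interlace. -/
def Interlaces {N m : ℕ} (x : Fin (m + 1) → Fin N) (y : Fin m → Fin N) : Prop :=
  ∀ b, x b.castSucc ≤ y b ∧ y b ≤ x b.succ

theorem StrictMono.card_filter_lt_le {N m : ℕ} {x : Fin m → Fin N} (hx : StrictMono x) {b : Fin m}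
    {k : ℕ} (h : k ≤ x b) : (Finset.univ.filter fun a => (x a).val < k).card ≤ b := by
  calc _ ≤ (Finset.Iio b).card := Finset.card_le_card fun a ha => by
        simp only [Finset.mem_filter, Finset.mem_univ, true_and, Finset.mem_Iio] at ha ⊢
        exact hx.lt_iff_lt.1 (Fin.lt_def.2 (ha.trans_le h))
    _ = b := Fin.card_Iio b

theorem StrictMono.lt_card_filter_lt {N m : ℕ} {x : Fin m → Fin N} (hx : StrictMono x) {b : Fin m}
    {k : ℕ} (h : (x b).val < k) : b.val < (Finset.univ.filter fun a => (x a).val < k).card := by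
  calc b.val < (Finset.Iic b).card := by simp
    _ ≤ _ := Finset.card_le_card fun a ha => by
        simp only [Finset.mem_filter, Finset.mem_univ, true_and, Finset.mem_Iic] at ha ⊢
        exact lt_of_le_of_lt (Fin.le_def.1 (hx.monotone ha)) h

theorem sum_indicator_image {N m : ℕ} {x : Fin m → Fin N} (hx : Function.Injective x) (k : ℕ) :
    (∑ j : Fin N with j.val < k, if j ∈ Finset.univ.image x then (1 : ℤ) else 0) =
      (Finset.univ.filter fun a => (x a).val < k).card := by
  rw [← Finset.sum_filter, Finset.sum_const, nsmul_one, Finset.filter_filter,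
    ← Finset.card_image_of_injective _ hx]
  congr 2
  ext j
  simp only [Finset.mem_filter, Finset.mem_univ, true_and, Finset.mem_image]
  constructor
  · rintro ⟨h, a, rfl⟩; exact ⟨a, h, rfl⟩
  · rintro ⟨a, h, rfl⟩; exact ⟨h, a, rfl⟩

theorem prefixSum_indicatorDiff_image {N m l : ℕ} {x : Fin m → Fin N} {y : Fin l → Fin N}
    (hx : Function.Injective x) (hy : Function.Injective y) (k : ℕ) :
    prefixSum (indicatorDiff (Finset.univ.image x) (Finset.univ.image y)) k =
      (Finset.univ.filter fun a => (x a).val < k).card -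
        (Finset.univ.filter fun a => (y a).val < k).card := by
  rw [prefixSum, ← sum_indicator_image hx, ← sum_indicator_image hy, ← Finset.sum_sub_distrib]
  exact Finset.sum_congr rfl fun j _ => coe_indicatorDiff _ _ j

/-- The partial sum of the row at `k` is the number of `x a` below `k` minus the number of `y a`
below `k`. Interlacing says that this difference is always `0` or `1`. -/
theorem isRowStep_image_iff {N m : ℕ} {x : Fin (m + 1) → Fin N} {y : Fin m → Fin N}
    (hx : StrictMono x) (hy : StrictMono y) :
    IsRowStep (Finset.univ.image x) (Finset.univ.image y) ↔ Interlaces x y := by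
  have key := prefixSum_indicatorDiff_image hx.injective hy.injective
  constructor
  · rintro ⟨h, -⟩ b
    constructor
    · by_contra! hlt
      -- Just past `y b` there would be more `y`'s than `x`'s.
      have h1 := hx.card_filter_lt_le (b := b.castSucc) (k := y b + 1) hlt
      have h2 := hy.lt_card_filter_lt (b := b) (k := y b + 1) (Nat.lt_succ_self _)
      have h3 := h (y b + 1)
      rw [key] at h3
      simp only [Fin.val_castSucc] at h1
      omega
    · by_contra! hlt
      -- Just past `x b.succ` the `x`'s would lead by at least two.
      have h1 := hy.card_filter_lt_le (b := b) (k := x b.succ + 1) hlt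
      have h2 := hx.lt_card_filter_lt (b := b.succ) (k := x b.succ + 1) (Nat.lt_succ_self _)
      have h3 := h (x b.succ + 1)
      rw [key] at h3
      simp only [Fin.val_succ] at h2
      omega
  · intro h
    constructor
    · intro k
      rw [key]
      have h1 : (Finset.univ.filter fun a => (y a).val < k).card ≤
          (Finset.univ.filter fun a => (x a).val < k).card := by
        refine Finset.card_le_card_of_injOn Fin.castSucc (fun a ha => ?_)
          (Fin.castSucc_injective m).injOn
        simp only [Finset.coe_filter, Finset.mem_univ, true_and, Set.mem_ofPred_eq] at ha ⊢
        exact lt_of_le_of_lt (Fin.le_def.1 (h a).1) ha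
      have h2 : (Finset.univ.filter fun a => (x a).val < k).card ≤
          (Finset.univ.filter fun a => (y a).val < k).card + 1 := by
        have : (Finset.univ.filter fun a : Fin m => (x a.succ).val < k).card ≤
            (Finset.univ.filter fun a => (y a).val < k).card :=
          Finset.card_le_card fun a ha => by
            simp only [Finset.mem_filter, Finset.mem_univ, true_and] at ha ⊢
            exact lt_of_le_of_lt (Fin.le_def.1 (h a).2) ha
        rw [Fin.card_filter_univ_succ]
        split_ifs <;> omega
      omega
    · rw [← prefixSum_of_le _ le_rfl, key]
      simp

/-- A column in both sets has entry `0` and weight `1`, which equals `cp * (cm / 2)` by `hc`. -/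
theorem prod_entryWeight_indicatorDiff {cp cm : ℕ → ℕ → ℚ} (hc : ∀ i j, cp i j * cm i j = 2)
    {N : ℕ} (m : ℕ) (X Y : Finset (Fin N)) :
    ∏ j : Fin N, entryWeight cp cm m j (indicatorDiff X Y j) =
      (∏ j ∈ X, cp m j) * ∏ j ∈ Y, if j ∈ X then cm m j / 2 else cm m j := by
  rw [← Finset.univ_inter X, ← Finset.univ_inter Y, ← Finset.prod_ite_mem, ← Finset.prod_ite_mem,
    ← Finset.prod_mul_distrib]
  refine Finset.prod_congr rfl fun j _ => ?_
  have h := hc m j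
  have h1 : (-1 : SignType) ≠ 1 := by decide
  have h2 : (0 : SignType) ≠ 1 := by decide
  have h3 : (0 : SignType) ≠ -1 := by decide
  unfold entryWeight indicatorDiff
  by_cases hX : j ∈ X <;> by_cases hY : j ∈ Y <;> simp [hX, hY, h1, h2, h3]
  linarith

open Classical in
theorem rectSum_succ_image {cp cm : ℕ → ℕ → ℚ} (hc : ∀ i j, cp i j * cm i j = 2)
    {N m : ℕ} {x : Fin (m + 1) → Fin N} (hx : StrictMono x) :
    rectSum cp cm (m + 1) (Finset.univ.image x) = (∏ b, cp m (x b)) *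
      ∑ y ∈ Fintype.piFinset (fun b : Fin m => Finset.Icc (x b.castSucc) (x b.succ)) with
        StrictMono y, (∏ b, if y b ∈ Finset.univ.image x then cm m (y b) / 2 else cm m (y b)) *
          rectSum cp cm m (Finset.univ.image y) := by
  have hmem : ∀ y : Fin m → Fin N,
      y ∈ Fintype.piFinset (fun b : Fin m => Finset.Icc (x b.castSucc) (x b.succ)) ↔
        Interlaces x y := fun y => by
    simp [Fintype.mem_piFinset, Interlaces]
  rw [rectSum_succ, Finset.mul_sum]
  symm
  refine Finset.sum_nbij (fun y => Finset.univ.image y) ?_ ?_ ?_ ?_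
  · intro y hy
    rw [Finset.mem_filter, hmem] at hy
    simpa using (isRowStep_image_iff hx hy.2).2 hy.1
  · intro y hy z hz h
    simp only [Finset.coe_filter, hmem, Set.mem_ofPred_eq] at hy hz
    have : Set.range y = Set.range z := by
      simpa using congrArg (fun s : Finset (Fin N) => (s : Set (Fin N))) h
    exact (hy.2.range_inj hz.2).1 this
  · intro Y hY
    simp only [Finset.coe_filter, Finset.mem_univ, true_and, Set.mem_ofPred_eq] at hY
    -- The row sum `1` makes the old support smaller by exactly one element.
    have hcard : Y.card = m := by
      have h := hY.2
      simp only [coe_indicatorDiff, Finset.sum_sub_distrib] at h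
      simp only [← Finset.sum_filter, Finset.filter_univ_mem, Finset.sum_const, nsmul_one,
        Finset.card_image_of_injective _ hx.injective, Finset.card_univ, Fintype.card_fin] at h
      push_cast at h
      omega
    have himage : Finset.univ.image (Y.orderEmbOfFin hcard) = Y := by
      apply Finset.coe_injective
      simp
    refine ⟨Y.orderEmbOfFin hcard, ?_, himage⟩
    simp only [Finset.coe_filter, hmem, Set.mem_ofPred_eq]
    have hs := (Y.orderEmbOfFin hcard).strictMono
    exact ⟨(isRowStep_image_iff hx hs).1 (by rwa [himage]), hs⟩
  · intro y hy
    rw [Finset.mem_filter, hmem] at hy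
    rw [prod_entryWeight_indicatorDiff hc, Finset.prod_image hx.injective.injOn,
      Finset.prod_image hy.2.injective.injOn, mul_assoc]

/-! ### The determinant formula -/

theorem Fin.sum_Icc_val {N : ℕ} (g : ℕ → ℚ) (u v : Fin N) :
    ∑ j ∈ Finset.Icc u v, g j = ∑ y ∈ Finset.Icc u.val v.val, g y := by
  rw [← Fin.map_valEmbedding_Icc, Finset.sum_map]
  rfl

/-- Halving both endpoints makes the sum a difference of values of one function of the endpoint. -/
theorem sum_Icc_half_endpoints (g : ℕ → ℚ) {u v : ℕ} (h : u < v) :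
    ∑ y ∈ Finset.Icc u v, (if y = u ∨ y = v then g y / 2 else g y) =
      (∑ y ∈ Finset.range v, g y + g v / 2) - (∑ y ∈ Finset.range u, g y + g u / 2) := by
  have h1 : ∀ y ∈ Finset.Icc u v, (if y = u ∨ y = v then g y / 2 else g y) =
      g y - (if y = u then g y / 2 else 0) - (if y = v then g y / 2 else 0) := fun y _ => by
    rcases eq_or_ne y u with rfl | hu
    · rw [if_pos (Or.inl rfl), if_pos rfl, if_neg h.ne]; ring
    · rcases eq_or_ne y v with rfl | hv
      · rw [if_pos (Or.inr rfl), if_neg hu, if_pos rfl]; ring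
      · rw [if_neg (by tauto), if_neg hu, if_neg hv]; ring
  rw [Finset.sum_congr rfl h1, Finset.sum_sub_distrib, Finset.sum_sub_distrib,
    Finset.sum_ite_eq', Finset.sum_ite_eq', if_pos (by simp [h.le]), if_pos (by simp [h.le]),
    show Finset.Icc u v = Finset.Ico u (v + 1) from rfl,
    Finset.sum_Ico_eq_sub _ (by omega), Finset.sum_range_succ]
  ring

/-- The entries of the determinants giving the generating functions by column support: the
functions for `m + 1` rows arise from those for `m` rows by weighted summation. -/
def stepFun (cp cm : ℕ → ℕ → ℚ) : ℕ → ℕ → ℕ → ℚ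
  -- Arbitrary value: with no rows the determinant is empty.
  | 0, _, _ => 0
  | m + 1, 0, x => cp m x
  | m + 1, a + 1, x => cp m x *
      (∑ y ∈ Finset.range x, cm m y * stepFun cp cm m a y + cm m x * stepFun cp cm m a x / 2)

/-- A determinant of consecutive differences as a determinant bordered by ones. -/
theorem det_differences {R : Type*} [CommRing R] {m : ℕ} (M : Fin (m + 1) → Fin m → R) :
    (Matrix.of fun b a : Fin m => M b.succ a - M b.castSucc a).det =
      (Matrix.of fun b a : Fin (m + 1) =>
        (Fin.cons 1 (M b) : Fin (m + 1) → R) a).det := by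
  symm
  rw [Matrix.det_eq_of_forall_row_eq_smul_add_pred (B := Matrix.of fun b a : Fin (m + 1) =>
    (Fin.cons (Fin.cons 1 (M 0)) (fun b' => Fin.cons 0 fun a' => M b'.succ a' - M b'.castSucc a') :
      Fin (m + 1) → Fin (m + 1) → R) b a) (fun _ => 1)]
  · rw [Matrix.det_succ_column_zero, Fin.sum_univ_succ]
    simp [Matrix.submatrix]
  · intro j
    simp
  · intro i j
    refine Fin.cases ?_ (fun j => ?_) j <;> simp

/-- Induction on the number of rows: multilinearity moves the sum over interlacing `y` into the rows
of the determinant, where it becomes a consecutive difference. `det_differences` then adds a column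
of ones, and the factors `cp m (x b)` scale the rows. -/
theorem rectSum_image {cp cm : ℕ → ℕ → ℚ} (hc : ∀ i j, cp i j * cm i j = 2) {N : ℕ} (m : ℕ)
    (x : Fin m → Fin N) (hx : StrictMono x) :
    rectSum cp cm m (Finset.univ.image x) =
      (Matrix.of fun b a : Fin m => stepFun cp cm m a (x b)).det := by
  classical
  induction m with
  | zero => simpa using rectSum_zero cp cm
  | succ m ih =>
    let κ : Fin N → ℚ := fun j => if j ∈ Finset.univ.image x then cm m j / 2 else cm m j
    let P : ℕ → ℕ → ℚ := fun a k => ∑ y ∈ Finset.range k, cm m y * stepFun cp cm m a y +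
      cm m k * stepFun cp cm m a k / 2
    rw [rectSum_succ_image hc hx]
    have hterm : ∀ y ∈ (Fintype.piFinset (fun b : Fin m =>
        Finset.Icc (x b.castSucc) (x b.succ))).filter StrictMono,
        (∏ b, if y b ∈ Finset.univ.image x then cm m (y b) / 2 else cm m (y b)) *
          rectSum cp cm m (Finset.univ.image y) =
        (Matrix.of fun b a : Fin m => κ (y b) * stepFun cp cm m a (y b)).det := fun y hy => by
      rw [ih y (Finset.mem_filter.1 hy).2]
      exact (Matrix.det_mul_column (fun b => κ (y b)) _).symm
    rw [Finset.sum_congr rfl hterm, Finset.sum_filter_of_ne]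
    -- Multilinearity needs independent choices of the `y b`, so the strictness condition has been
    -- dropped; the extra terms vanish by the last bullet.
    · have hsum := (Matrix.detRowAlternating (n := Fin m) (R := ℚ)).toMultilinearMap.map_sum_finset
        (fun (_ : Fin m) (j : Fin N) (a : Fin m) => κ j * stepFun cp cm m a j)
        (fun b => Finset.Icc (x b.castSucc) (x b.succ))
      have hrow : ∀ b : Fin m, (∑ j ∈ Finset.Icc (x b.castSucc) (x b.succ),
          fun a : Fin m => κ j * stepFun cp cm m a j) =
            fun a : Fin m => P a (x b.succ) - P a (x b.castSucc) := fun b => by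
        funext a
        have hlt : x b.castSucc < x b.succ := hx (Fin.castSucc_lt_succ)
        rw [Finset.sum_apply]
        have hk : ∀ j ∈ Finset.Icc (x b.castSucc) (x b.succ), κ j * stepFun cp cm m a j =
            if j.val = (x b.castSucc).val ∨ j.val = (x b.succ).val
              then cm m j * stepFun cp cm m a j / 2 else cm m j * stepFun cp cm m a j := fun j hj => by
          have hiff : j ∈ Finset.univ.image x ↔
              (j.val = (x b.castSucc).val ∨ j.val = (x b.succ).val) := by
            rw [Finset.mem_Icc] at hj
            simp only [Finset.mem_image, Finset.mem_univ, true_and, ← Fin.ext_iff]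
            constructor
            · rintro ⟨c, rfl⟩
              have h1 := hx.le_iff_le.1 hj.1
              have h2 := hx.le_iff_le.1 hj.2
              rw [Fin.le_def] at h1 h2
              simp only [Fin.val_castSucc, Fin.val_succ] at h1 h2
              rcases Nat.lt_or_ge b.val c.val with h | h
              · right; congr 1; ext; simp only [Fin.val_succ]; omega
              · left; congr 1; ext; simp only [Fin.val_castSucc]; omega
            · rintro (h | h)
              exacts [⟨_, h.symm⟩, ⟨_, h.symm⟩]
          simp only [κ, hiff]
          split_ifs <;> ring
        exact (Finset.sum_congr rfl hk).trans ((Fin.sum_Icc_val (fun y =>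
          if y = (x b.castSucc).val ∨ y = (x b.succ).val
            then cm m y * stepFun cp cm m a y / 2 else cm m y * stepFun cp cm m a y) _ _).trans
          (sum_Icc_half_endpoints (fun y => cm m y * stepFun cp cm m a y) hlt))
      simp only [hrow] at hsum
      have hsum' : (Matrix.of fun b a : Fin m => P a (x b.succ) - P a (x b.castSucc)).det =
          ∑ y ∈ Fintype.piFinset (fun b : Fin m => Finset.Icc (x b.castSucc) (x b.succ)),
            (Matrix.of fun b a : Fin m => κ (y b) * stepFun cp cm m a (y b)).det := hsum
      rw [← hsum', det_differences (fun b (a : Fin m) => P a (x b)), ← Matrix.det_mul_column]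
      congr 1
      ext b a
      refine Fin.cases ?_ (fun a => ?_) a <;> simp [stepFun, P]
    · intro y hy hne
      by_contra hmono
      apply hne
      simp only [Fintype.mem_piFinset, Finset.mem_Icc] at hy
      cases m with
      | zero => exact absurd (Subsingleton.strictMono y) hmono
      | succ m =>
        rw [Fin.strictMono_iff_lt_succ] at hmono
        push Not at hmono
        obtain ⟨b, hb⟩ := hmono
        -- Interlacing tuples are weakly increasing, so failure of strictness gives two equal rows.
        have heq : y b.castSucc = y b.succ :=
          le_antisymm ((hy b.castSucc).2.trans (by simpa using (hy b.succ).1)) hb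
        refine Matrix.det_zero_of_row_eq (i := b.castSucc) (j := b.succ)
          (Fin.castSucc_lt_succ).ne ?_
        funext a
        simp [heq]

/-! ### Polynomials in the binomial basis -/

/-- The sequence `p` is a polynomial, given as a combination of the binomial
coefficients `k.choose i` with `i ≤ d`, the coefficient at `i = d` being `c`. -/
def IsBinomialSum (d : ℕ) (c : ℚ) (p : ℕ → ℚ) : Prop :=
  ∃ e : ℕ → ℚ, e d = c ∧ ∀ k, p k = ∑ i ∈ Finset.range (d + 1), e i * k.choose i

theorem IsBinomialSum.congr {d : ℕ} {c c' : ℚ} {p q : ℕ → ℚ} (h : IsBinomialSum d c p)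
    (hc : c = c') (hpq : ∀ k, q k = p k) : IsBinomialSum d c' q := by
  obtain ⟨e, he, hp⟩ := h
  exact ⟨e, he.trans hc, fun k => (hpq k).trans (hp k)⟩

theorem isBinomialSum_const (c : ℚ) : IsBinomialSum 0 c fun _ => c :=
  ⟨fun _ => c, rfl, fun k => by simp⟩

theorem IsBinomialSum.add {d : ℕ} {c c' : ℚ} {p q : ℕ → ℚ} (hp : IsBinomialSum d c p)
    (hq : IsBinomialSum d c' q) : IsBinomialSum d (c + c') fun k => p k + q k := by
  obtain ⟨e, he, hp⟩ := hp
  obtain ⟨e', he', hq⟩ := hq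
  exact ⟨fun i => e i + e' i, by simp only [he, he'], fun k => by
    simp only [hp, hq, ← Finset.sum_add_distrib]
    exact Finset.sum_congr rfl fun i _ => by ring⟩

theorem IsBinomialSum.const_mul {d : ℕ} {c : ℚ} {p : ℕ → ℚ} (r : ℚ) (hp : IsBinomialSum d c p) :
    IsBinomialSum d (r * c) fun k => r * p k := by
  obtain ⟨e, he, hp⟩ := hp
  exact ⟨fun i => r * e i, by simp only [he], fun k => by
    simp only [hp, Finset.mul_sum]
    exact Finset.sum_congr rfl fun i _ => by ring⟩

theorem IsBinomialSum.raise {d : ℕ} {c : ℚ} {p : ℕ → ℚ} (hp : IsBinomialSum d c p) :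
    IsBinomialSum (d + 1) 0 p := by
  obtain ⟨e, -, hp⟩ := hp
  refine ⟨fun i => if i = d + 1 then 0 else e i, if_pos rfl, fun k => ?_⟩
  rw [Finset.sum_range_succ, hp]
  simp only [if_true, zero_mul, add_zero]
  refine Finset.sum_congr rfl fun i hi => ?_
  rw [if_neg (Finset.mem_range.1 hi).ne]

theorem sum_range_choose_right (k i : ℕ) :
    ∑ j ∈ Finset.range k, (j.choose i : ℚ) = k.choose (i + 1) := by
  induction k with
  | zero => simp
  | succ k ih => rw [Finset.sum_range_succ, ih, Nat.choose_succ_succ]; push_cast; ring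

theorem IsBinomialSum.sum_range {d : ℕ} {c : ℚ} {p : ℕ → ℚ} (hp : IsBinomialSum d c p) :
    IsBinomialSum (d + 1) c fun k => ∑ j ∈ Finset.range k, p j := by
  obtain ⟨e, he, hp⟩ := hp
  -- Summation shifts the coefficients by one degree; the new constant term is `0`.
  refine ⟨fun i => Nat.casesOn i 0 e, he, fun k => ?_⟩
  simp only [Finset.sum_range_succ' _ (d + 1), hp]
  rw [Finset.sum_comm]
  simp [← Finset.mul_sum, sum_range_choose_right]

theorem sum_range_two_mul (g : ℕ → ℚ) (k : ℕ) :
    ∑ y ∈ Finset.range (2 * k), g y = ∑ j ∈ Finset.range k, (g (2 * j) + g (2 * j + 1)) := by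
  induction k with
  | zero => simp
  | succ k ih =>
    rw [Nat.mul_succ, Finset.sum_range_succ, Finset.sum_range_succ, ih, Finset.sum_range_succ]
    ring

/-- A determinant of binomial sums of degrees `0, 1, …, n - 1` is the product of the leading
coefficients. -/
theorem det_isBinomialSum {n : ℕ} (c : ℕ → ℚ) (p : ℕ → ℕ → ℚ)
    (h : ∀ a < n, IsBinomialSum a (c a) (p a)) :
    (Matrix.of fun k a : Fin n => p a k).det = ∏ a ∈ Finset.range n, c a := by
  choose! e he hp using h
  -- Factor into a unitriangular matrix of binomial coefficients and an upper triangular matrix of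
  -- coefficients.
  have hmul : (Matrix.of fun k a : Fin n => p a k) =
      (Matrix.of fun k i : Fin n => ((k.val.choose i.val : ℕ) : ℚ)) *
        Matrix.of fun i a : Fin n => if i ≤ a then e a i else 0 := by
    ext k a
    rw [Matrix.mul_apply]
    simp only [Matrix.of_apply, Fin.le_def]
    rw [hp a a.isLt, Fin.sum_univ_eq_sum_range
      (fun i => (k.val.choose i : ℚ) * if i ≤ a.val then e a i else 0) n]
    have hsub : Finset.range (a.val + 1) ⊆ Finset.range n := by
      intro i; simp only [Finset.mem_range]; omega
    rw [← Finset.sum_subset hsub]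
    · refine Finset.sum_congr rfl fun i hi => ?_
      rw [if_pos (by simpa [Nat.lt_succ_iff] using hi), mul_comm]
    · intro i _ hi
      rw [if_neg (by simpa [Nat.lt_succ_iff] using hi), mul_zero]
  rw [hmul, Matrix.det_mul, Matrix.det_of_isLowerTriangular, Matrix.det_of_isUpperTriangular]
  · simp only [Matrix.of_apply, Nat.choose_self, Nat.cast_one, Finset.prod_const_one, one_mul,
      le_refl, if_true]
    rw [Finset.prod_range]
    exact Finset.prod_congr rfl fun a _ => he a a.isLt
  · intro i j hij
    exact if_neg (not_le.2 hij)
  · intro i j hij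
    have : i < j := hij
    simp [Nat.choose_eq_zero_of_lt (Fin.lt_def.1 this)]

/-! ### The parity weights -/

/-- The weight of an entry `1`, for rows and columns numbered from `0`. -/
def plusWeight (i j : ℕ) : ℚ := if Even (i + j) then 1 else 2

/-- The weight of an entry `-1`, for rows and columns numbered from `0`. -/
def minusWeight (i j : ℕ) : ℚ := if Even (i + j) then 2 else 1

theorem plusWeight_mul_minusWeight (i j : ℕ) : plusWeight i j * minusWeight i j = 2 := by
  unfold plusWeight minusWeight
  split_ifs <;> norm_num

/-- The weights are constant on each parity class of columns. Summing over pairs of columns raises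
the degree by one, while the boundary terms keep degree `a` and do not affect the new top
coefficient. -/
theorem isBinomialSum_stepFun (m a : ℕ) (ha : a ≤ m) :
    IsBinomialSum a (plusWeight m 0 * 5 ^ a)
      (fun k => stepFun plusWeight minusWeight (m + 1) a (2 * k)) ∧
    IsBinomialSum a (minusWeight m 0 * 5 ^ a)
      (fun k => stepFun plusWeight minusWeight (m + 1) a (2 * k + 1)) := by
  have hp0 : ∀ m k, plusWeight m (2 * k) = plusWeight m 0 := fun m k => by
    simp [plusWeight, Nat.even_add]
  have hp1 : ∀ m k, plusWeight m (2 * k + 1) = minusWeight m 0 := fun m k => by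
    by_cases h : Even m <;> simp [plusWeight, minusWeight, Nat.even_add, h]
  have hm0 : ∀ m k, minusWeight m (2 * k) = minusWeight m 0 := fun m k => by
    simp [minusWeight, Nat.even_add]
  have hm1 : ∀ m k, minusWeight m (2 * k + 1) = plusWeight m 0 := fun m k => by
    by_cases h : Even m <;> simp [plusWeight, minusWeight, Nat.even_add, h]
  induction a generalizing m with
  | zero =>
    simp only [stepFun, hp0, hp1, pow_zero, mul_one]
    exact ⟨isBinomialSum_const _, isBinomialSum_const _⟩
  | succ a ih =>
    obtain ⟨m, rfl⟩ : ∃ l, m = l + 1 := ⟨m - 1, by omega⟩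
    obtain ⟨hp, hq⟩ := ih m (by omega)
    have hw : plusWeight (m + 1) 0 = minusWeight m 0 ∧ minusWeight (m + 1) 0 = plusWeight m 0 := by
      by_cases h : Even m <;> simp [plusWeight, minusWeight, Nat.even_add_one, h]
    have hF := ((hp.const_mul (minusWeight (m + 1) 0)).add
      (hq.const_mul (plusWeight (m + 1) 0))).sum_range
    have hlead : minusWeight (m + 1) 0 * (plusWeight m 0 * 5 ^ a) +
        plusWeight (m + 1) 0 * (minusWeight m 0 * 5 ^ a) = (5 : ℚ) ^ (a + 1) := by
      -- Passing to the next row swaps the two weights, so the factor is the sum of their squares,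
      -- `1 + 4 = 5`.
      rw [hw.1, hw.2]
      by_cases h : Even m <;> simp [plusWeight, minusWeight, h] <;> ring
    rw [hlead] at hF
    constructor
    · refine ((hF.add (hp.const_mul (minusWeight (m + 1) 0 / 2)).raise).const_mul
        (plusWeight (m + 1) 0)).congr (by ring) fun k => ?_
      rw [stepFun, sum_range_two_mul]
      simp only [hp0, hm0, hm1]
      ring
    · refine (((hF.add (hp.const_mul (minusWeight (m + 1) 0)).raise).add
        (hq.const_mul (plusWeight (m + 1) 0 / 2)).raise).const_mul
        (minusWeight (m + 1) 0)).congr (by ring) fun k => ?_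
      rw [stepFun, Finset.sum_range_succ, sum_range_two_mul]
      simp only [hp1, hm0, hm1]
      ring

/-! ### The boundary form as a choice from each pair -/

/-- The tuple choosing one element of each pair `{2 k, 2 k + 1}`. -/
def pairChoice {n : ℕ} (ε : Fin n → Fin 2) (k : Fin n) : Fin (2 * n) :=
  ⟨2 * k + ε k, by omega⟩

theorem pairChoice_strictMono {n : ℕ} (ε : Fin n → Fin 2) : StrictMono (pairChoice ε) := by
  intro a b h
  simp only [pairChoice, Fin.lt_def] at h ⊢
  omega

theorem mem_image_pairChoice {n : ℕ} (ε : Fin n → Fin 2) (j : Fin (2 * n)) (k : Fin n)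
    (s : Fin 2) (hj : j.val = 2 * k + s) : j ∈ Finset.univ.image (pairChoice ε) ↔ ε k = s := by
  simp only [Finset.mem_image, Finset.mem_univ, true_and, pairChoice, Fin.ext_iff]
  constructor
  · rintro ⟨l, hl⟩
    have : l = k := by ext; omega
    subst this
    omega
  · intro h
    exact ⟨k, by omega⟩

theorem image_pairChoice_injective {n : ℕ} :
    Function.Injective fun ε : Fin n → Fin 2 => Finset.univ.image (pairChoice ε) := by
  intro ε δ h
  funext k
  have h1 := mem_image_pairChoice δ (pairChoice ε k) k (ε k) rfl
  rw [← show Finset.univ.image (pairChoice ε) = Finset.univ.image (pairChoice δ) from h,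
    mem_image_pairChoice ε _ k (ε k) rfl] at h1
  exact (h1.1 rfl).symm

/-- Only the last row is a real condition: the first row and column involve empty sums, and the last
column follows from the row sums. -/
theorem hasBoundaryForm_iff {n : ℕ} {A : Matrix (Fin n) (Fin (2 * n)) SignType}
    (hA : ∀ i, ∑ j, (A i j : ℤ) = 1) :
    HasBoundaryForm (heightMatrix A) ↔
      ∀ k ≤ n, ∑ r : Fin (2 * n) with r.val < 2 * k, ∑ l, (A l r : ℤ) = k := by
  have hlast : ∀ j : Fin (2 * n + 1), heightMatrix A (Fin.last n) j =
      n + j.val - 2 * ∑ r : Fin (2 * n) with r.val < j.val, ∑ l, (A l r : ℤ) := fun j => by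
    rw [heightMatrix, Finset.sum_comm]
    simp
  constructor
  · intro h k hk
    have h1 := h.last_row ⟨2 * k, by omega⟩ (even_two_mul k)
    rw [hlast] at h1
    push_cast at h1
    linarith
  · intro h
    refine ⟨fun j => by simp [heightMatrix], fun i => by simp [heightMatrix], fun i => ?_,
      fun j hj => ?_⟩
    · have h1 : ∑ l : Fin n with l.val < i.val,
          ∑ r : Fin (2 * n) with r.val < (Fin.last (2 * n)).val, (A l r : ℤ) = i.val := by
        have h2 : ∀ l : Fin n, ∑ r : Fin (2 * n) with r.val < (Fin.last (2 * n)).val,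
            (A l r : ℤ) = 1 := fun l => by
          rw [← hA l, Finset.filter_true_of_mem fun r _ => r.isLt]
        simp only [h2, Finset.sum_const, nsmul_one, Fin.card_filter_val_lt]
        congr 1
        omega
      rw [heightMatrix, h1, Fin.val_last]
      push_cast
      ring
    · obtain ⟨k, hk⟩ := hj
      have hk' : j.val = 2 * k := by omega
      rw [hlast, hk', h k (by omega)]
      push_cast
      ring

theorem sum_filter_lt_two_mul_eq_iff {n : ℕ} (f : Fin (2 * n) → ℤ) :
    (∀ k ≤ n, ∑ r : Fin (2 * n) with r.val < 2 * k, f r = k) ↔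
      ∀ k : Fin n, f ⟨2 * k, by omega⟩ + f ⟨2 * k + 1, by omega⟩ = 1 := by
  have hs : ∀ k : Fin n, ∑ r : Fin (2 * n) with r.val < 2 * (k.val + 1), f r =
      ∑ r : Fin (2 * n) with r.val < 2 * k.val, f r +
        (f ⟨2 * k, by omega⟩ + f ⟨2 * k + 1, by omega⟩) := fun k => by
    have h1 := Fin.sum_filter_val_lt_succ f ⟨2 * k, by omega⟩
    have h2 := Fin.sum_filter_val_lt_succ f ⟨2 * k + 1, by omega⟩
    simp only at h1 h2
    rw [mul_add, mul_one, ← add_assoc, ← h1]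
    exact h2
  constructor
  · intro h k
    have h1 := hs k
    rw [h _ k.isLt, h k k.isLt.le] at h1
    push_cast at h1
    linarith
  · intro h k
    induction k with
    | zero => simp
    | succ k ih =>
      intro hk
      have h1 := hs ⟨k, hk⟩
      rw [h ⟨k, hk⟩, ih (by omega)] at h1
      push_cast
      exact h1

theorem hasColumnSupport_pairChoice_iff {n : ℕ} {A : Fin n → Fin (2 * n) → SignType}
    (hA : IsHalvedRect A) :
    (∃ ε, HasColumnSupport A (Finset.univ.image (pairChoice ε))) ↔
      ∀ k : Fin n, ∑ i, (A i ⟨2 * k, by omega⟩ : ℤ) + ∑ i, (A i ⟨2 * k + 1, by omega⟩ : ℤ) = 1 := by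
  constructor
  · rintro ⟨ε, h⟩ k
    rw [h, h, if_congr (mem_image_pairChoice ε _ k 0 rfl) rfl rfl,
      if_congr (mem_image_pairChoice ε _ k 1 rfl) rfl rfl]
    generalize ε k = s
    fin_cases s <;> simp
  · intro h
    refine ⟨fun k => if ∑ i, (A i ⟨2 * k, by omega⟩ : ℤ) = 1 then 0 else 1, fun j => ?_⟩
    have hk := h ⟨j / 2, by omega⟩
    have h0 := (hA.col ⟨2 * (j / 2), by omega⟩).sum_eq
    rcases Nat.mod_two_eq_zero_or_one j.val with hj | hj
    · have e : j = ⟨2 * (j / 2), by omega⟩ := by ext; simp only; omega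
      rw [if_congr (mem_image_pairChoice _ j ⟨j / 2, by omega⟩ 0 (by simp; omega)) rfl rfl]
      simp only at hk ⊢
      rw [← e] at hk h0 ⊢
      rcases h0 with h0 | h0 <;> simp [h0]
    · have e : j = ⟨2 * (j / 2) + 1, by omega⟩ := by ext; simp only; omega
      rw [if_congr (mem_image_pairChoice _ j ⟨j / 2, by omega⟩ 1 (by simp; omega)) rfl rfl]
      simp only at hk ⊢
      rw [← e] at hk
      rcases h0 with h0 | h0
      · rw [h0] at hk ⊢
        simpa using hk
      · rw [h0] at hk ⊢
        simpa using hk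

/-! ### Summation over the choices -/

theorem two_pow_eq_rectWeight {n : ℕ} (A : Matrix (Fin n) (Fin (2 * n)) SignType) :
    (2 : ℚ) ^ (numNegEven A + numPosOdd A) = rectWeight plusWeight minusWeight fun i j => A i j := by
  have hpow : ∀ p : Fin n × Fin (2 * n) → Prop, ∀ [DecidablePred p],
      (2 : ℚ) ^ (Finset.univ.filter p).card = ∏ x, if p x then 2 else 1 := fun p _ => by
    rw [Finset.prod_ite, Finset.prod_const, Finset.prod_const_one, mul_one]
  rw [pow_add, numNegEven, numPosOdd, hpow, hpow, ← Finset.prod_mul_distrib, rectWeight,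
    ← Fintype.prod_prod_type']
  refine Finset.prod_congr rfl fun x _ => ?_
  have hpar : Even (x.1.val + 1 + (x.2.val + 1)) ↔ Even (x.1.val + x.2.val) := by
    simp only [Nat.even_iff]; omega
  have h1 : (-1 : SignType) ≠ 1 := by decide
  have h2 : (1 : SignType) ≠ -1 := by decide
  have h3 : (0 : SignType) ≠ 1 := by decide
  have h4 : (0 : SignType) ≠ -1 := by decide
  simp only [← Nat.not_even_iff_odd, hpar]
  unfold entryWeight plusWeight minusWeight
  by_cases he : Even (x.1.val + x.2.val) <;>
    rcases SignType.trichotomy (A x.1 x.2) with h | h | h <;> simp [h, he, h1, h2, h3, h4]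

theorem sum_boundedHalvedASMs (n : ℕ) :
    ∑ A ∈ boundedHalvedASMs n, (2 : ℚ) ^ (numNegEven A + numPosOdd A) =
      ∑ ε : Fin n → Fin 2, rectSum plusWeight minusWeight n (Finset.univ.image (pairChoice ε)) := by
  classical
  simp only [rectSum]
  rw [Finset.sum_sigma']
  symm
  refine Finset.sum_nbij (fun p => Matrix.of p.2) ?_ ?_ ?_ ?_
  · rintro ⟨ε, A⟩ h
    simp only [Finset.mem_sigma, Finset.mem_filter, Finset.mem_univ, true_and] at h
    simp only [boundedHalvedASMs, Finset.mem_filter, Finset.mem_univ, true_and]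
    refine ⟨(isHalvedASM_iff _).2 h.1, (hasBoundaryForm_iff h.1.row_sum).2 ?_⟩
    rw [sum_filter_lt_two_mul_eq_iff]
    exact (hasColumnSupport_pairChoice_iff h.1).1 ⟨ε, h.2⟩
  · rintro ⟨ε, A⟩ h ⟨δ, B⟩ h' hAB
    simp only [Finset.coe_sigma, Set.mem_sigma_iff, Finset.coe_filter, Finset.mem_univ, true_and,
      Set.mem_ofPred_eq] at h h'
    obtain rfl : A = B := hAB
    obtain rfl : ε = δ := image_pairChoice_injective (h.2.2.eq.symm.trans h'.2.2.eq)
    rfl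
  · intro A hA
    simp only [boundedHalvedASMs, Finset.coe_filter, Finset.mem_univ, true_and,
      Set.mem_ofPred_eq] at hA
    have hr := (isHalvedASM_iff A).1 hA.1
    have hb := (hasBoundaryForm_iff hr.row_sum).1 hA.2
    rw [sum_filter_lt_two_mul_eq_iff] at hb
    obtain ⟨ε, hε⟩ := (hasColumnSupport_pairChoice_iff hr).2 hb
    exact ⟨⟨ε, fun i j => A i j⟩, by simpa using ⟨hr, hε⟩, rfl⟩
  · rintro ⟨ε, A⟩ _
    exact (two_pow_eq_rectWeight (Matrix.of A)).symm

theorem sum_det_pairChoice {n : ℕ} (f : ℕ → ℕ → ℚ) :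
    ∑ ε : Fin n → Fin 2, (Matrix.of fun k a : Fin n => f a (pairChoice ε k)).det =
      (Matrix.of fun k a : Fin n => f a (2 * k) + f a (2 * k + 1)).det := by
  have h := (Matrix.detRowAlternating (n := Fin n) (R := ℚ)).toMultilinearMap.map_sum
    (fun (k : Fin n) (s : Fin 2) (a : Fin n) => f a (2 * k + s))
  refine Eq.trans h.symm ?_
  refine congrArg Matrix.det ?_
  ext k a
  simp [Fin.sum_univ_two]

theorem theorem2 (n : ℕ) :
    ∑ A ∈ boundedHalvedASMs n, (2 : ℕ) ^ (numNegEven A + numPosOdd A) =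
      3 ^ n * 5 ^ (n.choose 2) := by
  have key : ∑ A ∈ boundedHalvedASMs n, (2 : ℚ) ^ (numNegEven A + numPosOdd A) =
      3 ^ n * 5 ^ (n.choose 2) := by
    rw [sum_boundedHalvedASMs, Finset.sum_congr rfl fun ε _ =>
      rectSum_image plusWeight_mul_minusWeight n _ (pairChoice_strictMono ε),
      sum_det_pairChoice, det_isBinomialSum (fun a => 3 * 5 ^ a)
        (fun a k => stepFun plusWeight minusWeight n a (2 * k) +
          stepFun plusWeight minusWeight n a (2 * k + 1)),
      Finset.prod_mul_distrib, Finset.prod_const, Finset.card_range, Finset.prod_pow_eq_pow_sum,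
      Finset.sum_range_id, Nat.choose_two_right]
    intro a ha
    obtain ⟨m, rfl⟩ : ∃ m, n = m + 1 := ⟨n - 1, by omega⟩
    have h := isBinomialSum_stepFun m a (by omega)
    refine (h.1.add h.2).congr ?_ fun _ => rfl
    rw [← add_mul]
    -- The two weights are `1` and `2` in some order, whence the factor `3`.
    by_cases hm : Even m <;> simp [plusWeight, minusWeight, hm] <;> norm_num
  exact_mod_cast key
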